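/- Let $X$ be a set. A map $\rho = (\rho_1,\rho_2) : X\times X\to X\times X$ is an \emph{involutive nondegenerate set-theoretic solution of the Yang--Baxter equation} if $\rho^{12}\rho^{23}\rho^{12}=\rho^{23}\rho^{12}\rho^{23}$ on $X^3$, $\rho\circ\rho=\mathrm{id}$, and all maps $b\mapsto\rho_1(a,b)$ and $a\mapsto\rho_2(a,b)$ are bijections of $X$. A binary operation $*$ on $X$ is an \emph{RC-quasigroup} if $(x*y)*(x*z)=(y*x)*(y*z)$ holds for all $x,y,z$ and all left translations $y\mapsto x*y$ are bijective; it is \emph{bijective} if moreover $(x,y)\mapsto(x*y,\,y*x)$ is a bijection of $X\times X$. The structure monoid (resp. group) of $(X,\rho)$ is the monoid (resp. group) generated by $X$ with the relations $ab=a'b'$ for $\rho(a,b)=(a',b')$; that of $(X,*)$ is generated by $X$ with the relations $a(a*b)=b(b*a)$. A \emph{Garside monoid} is a pair $(M,\Delta)$ where $M$ is a left- and right-cancellative monoid that admits a map $\lambda:M\to\mathbb N$ with $\lambda(fg)\ge\lambda(f)+\lambda(g)$ and $\lambda(g)\neq0$ for $g\ne1$, in which any two elements have left- and right-lcms and left-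 and right-gcds, and $\Delta\in M$ is an element whose left- and right-divisors coincide, are finite in number, and generate $M$. A \emph{Garside group} is a group of fractions of a Garside monoid. A \emph{right-I-structure} on a monoid $M$ generated by (the image under a map $\iota:X\to M$ of) $X$ is a bijection $\nu:\mathbb N^{(X)}\to M$ from the free abelian monoid on $X$, written multiplicatively, with $\nu(1)=1$, $\nu(s)=\iota(s)$ for $s\in X$, and $\{\nu(as)\mid s\in X\}=\{\nu(a)\iota(s)\mid s\in X\}$ for every $a$; a \emph{left-I-structure} is defined symmetrically, with $\{\iota(s)\nu(a)\mid s\in X\}$. Then the following hold. 1. The relation $\rho(a,a*b)=(b,b*a)$ (for all $a,b\in X$) defines a one-to-one correspondence between involutive nondegenerate set-theoretic solutions $\rho$ of the Yang--Baxter equation on $X$ and bijective RC-quasigroup operations $*$ on $X$. If $X$ is finite, every RC-quasigroup operation on $X$ is bijective. If $\rho$ and $*$ correspond to each other, the identity of $X$ induces isomorphisms between their structure monoids and between their structure groups. 2. Let $\rho$ be an involutive nondegenerate solution on $X$, with structure monoid $M$ and structure group $G$. Then $M$ is left- and right-cancellative, admits a map $\lambda$ as above, and any two elements of $M$ have left-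 and right-lcms and left- and right-gcds; the canonical morphism $M\to G$ is injective and $G$ is a group of left and of right fractions of $M$. If moreover $X$ is finite, there exists $\Delta\in M$ such that $(M,\Delta)$ is a Garside monoid, and $G$ is a Garside group. 3. Let $X$ be finite and let $*$ be an RC-quasigroup operation on $X$, with structure monoid $M$ and structure group $G$. Then there exists $\Delta\in M$ such that $(M,\Delta)$ is a Garside monoid, $G$ is a Garside group, the canonical morphism $M\to G$ is injective, and $G$ is a group of left and of right fractions of $M$. 4. For every RC-quasigroup operation $*$ on $X$, the structure monoid of $(X,*)$ has a right-I-structure $\nu$ that satisfies $\nu(st)=s\,(s*t)$ for all $s,t\in X$. 5. Let $X$ be finite, let $M$ be a monoid and let $\iota:X\to M$ be a map. For every right-I-structure $\nu$ on $M$ with respect to $\iota$, there is a unique operation $*$ on $X$ such that $(X,*)$ is an RC-quasigroup, $M$ is its structure monoid via $\iota$ (that is, $\iota$ induces an isomorphism from the structure monoid onto $M$), and $\nu(st)=\iota(s)\,\iota(s*t)$ for all $s,t\in X$. Moreover the following are equivalent: (i) $M$ has a right-I-structure with respect to $\iota$; (ii) $M$ has a left-I-structure with respect to $\iota$; (iii)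 $M$ is, via $\iota$, the structure monoid of an RC-quasigroup on $X$; (iv) $M$ is, via $\iota$, the structure monoid of an involutive nondegenerate set-theoretic solution of the Yang--Baxter equation on $X$. -/

import Mathlib

universe u v

namespace YB

/-! ### Solutions of the Yang-Baxter equation and RC-quasigroups -/

section Solutions

variable {X : Type u}

/-- `ρ` acting on the first two coordinates of `X × X × X`. -/
def act12 (ρ : X × X → X × X) : X × X × X → X × X × X :=
  fun p => ((ρ (p.1, p.2.1)).1, (ρ (p.1, p.2.1)).2, p.2.2)

/-- `ρ` acting on the last two coordinates of `X × X × X`. -/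
def act23 (ρ : X × X → X × X) : X × X × X → X × X × X :=
  fun p => (p.1, ρ p.2)

/-- An involutive nondegenerate set-theoretic solution `(X, ρ)` of the Yang-Baxter equation
(in its braid form). -/
structure IsSolution (ρ : X × X → X × X) : Prop where
  yang_baxter : act12 ρ ∘ act23 ρ ∘ act12 ρ = act23 ρ ∘ act12 ρ ∘ act23 ρ
  involutive : Function.Involutive ρ
  left_nondegenerate : ∀ a : X, Function.Bijective fun b : X => (ρ (a, b)).1
  right_nondegenerate : ∀ b : X, Function.Bijective fun a : X => (ρ (a, b)).2

/-- An RC-quasigroup: the right-cyclic law `(x * y) * (x * z) = (y * x) * (y * z)` holds, and all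
left translations are bijective. -/
structure IsRCQuasigroup (op : X → X → X) : Prop where
  rc_law : ∀ x y z : X, op (op x y) (op x z) = op (op y x) (op y z)
  bijective_left : ∀ x : X, Function.Bijective (op x)

/-- A bijective RC-quasigroup: moreover `(x, y) ↦ (x * y, y * x)` is a bijection of `X × X`. -/
structure IsBijectiveRCQuasigroup (op : X → X → X) : Prop extends IsRCQuasigroup op where
  bijective_pair : Function.Bijective fun p : X × X => (op p.1 p.2, op p.2 p.1)

/-- The relation that links a solution `ρ` and an operation `*`: one has
`ρ (a, a * b) = (b, b * a)` for all `a`, `b`. -/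
def Corresponds (ρ : X × X → X × X) (op : X → X → X) : Prop :=
  ∀ a b : X, ρ (a, op a b) = (b, op b a)

/-! ### Structure monoids and structure groups -/

/-- The defining relations `a b = a' b'` for `ρ (a, b) = (a', b')`. -/
def solutionRel (ρ : X × X → X × X) (u v : FreeMonoid X) : Prop :=
  ∃ a b : X, u = FreeMonoid.of a * FreeMonoid.of b ∧
    v = FreeMonoid.of (ρ (a, b)).1 * FreeMonoid.of (ρ (a, b)).2

/-- The structure monoid of `(X, ρ)`. -/
abbrev StructureMonoid (ρ : X × X → X × X) : Type u := PresentedMonoid (solutionRel ρ)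

/-- The structure group of `(X, ρ)`: the group with the same presentation. -/
abbrev StructureGroup (ρ : X × X → X × X) : Type u :=
  PresentedGroup {g : FreeGroup X | ∃ a b : X,
    g = FreeGroup.of a * FreeGroup.of b *
      (FreeGroup.of (ρ (a, b)).1 * FreeGroup.of (ρ (a, b)).2)⁻¹}

/-- The defining relations `a (a * b) = b (b * a)`. -/
def rcRel (op : X → X → X) (u v : FreeMonoid X) : Prop :=
  ∃ a b : X, u = FreeMonoid.of a * FreeMonoid.of (op a b) ∧
    v = FreeMonoid.of b * FreeMonoid.of (op b a)

/-- The structure monoid of `(X, *)`. -/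
abbrev RCStructureMonoid (op : X → X → X) : Type u := PresentedMonoid (rcRel op)

/-- The structure group of `(X, *)`. -/
abbrev RCStructureGroup (op : X → X → X) : Type u :=
  PresentedGroup {g : FreeGroup X | ∃ a b : X,
    g = FreeGroup.of a * FreeGroup.of (op a b) * (FreeGroup.of b * FreeGroup.of (op b a))⁻¹}

end Solutions

/-! ### Garside monoids and Garside groups -/

section Garside

variable {M : Type u} [Monoid M]

/-- `f` left-divides `g`. -/
def LeftDvd (f g : M) : Prop := ∃ h : M, f * h = g

/-- `f` right-divides `g`. -/
def RightDvd (f g : M) : Prop := ∃ h : M, h * f = g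

/-- `h` is a right-lcm of `f` and `g`: a least common right-multiple. -/
def IsRightLcm (f g h : M) : Prop :=
  LeftDvd f h ∧ LeftDvd g h ∧ ∀ k : M, LeftDvd f k → LeftDvd g k → LeftDvd h k

/-- `h` is a left-lcm of `f` and `g`: a least common left-multiple. -/
def IsLeftLcm (f g h : M) : Prop :=
  RightDvd f h ∧ RightDvd g h ∧ ∀ k : M, RightDvd f k → RightDvd g k → RightDvd h k

/-- `h` is a left-gcd of `f` and `g`: a greatest common left-divisor. -/
def IsLeftGcd (f g h : M) : Prop :=
  LeftDvd h f ∧ LeftDvd h g ∧ ∀ k : M, LeftDvd k f → LeftDvd k g → LeftDvd k h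

/-- `h` is a right-gcd of `f` and `g`: a greatest common right-divisor. -/
def IsRightGcd (f g h : M) : Prop :=
  RightDvd h f ∧ RightDvd h g ∧ ∀ k : M, RightDvd k f → RightDvd k g → RightDvd k h

variable (M) in
/-- The part of the definition of a Garside monoid that does not involve the Garside element. -/
structure IsGaussianMonoid : Prop where
  mul_left_cancel : ∀ f g h : M, f * g = f * h → g = h
  mul_right_cancel : ∀ f g h : M, g * f = h * f → g = h
  exists_length : ∃ l : M → ℕ, (∀ f g : M, l f + l g ≤ l (f * g)) ∧ ∀ g : M, g ≠ 1 → l g ≠ 0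
  exists_rightLcm : ∀ f g : M, ∃ h : M, IsRightLcm f g h
  exists_leftLcm : ∀ f g : M, ∃ h : M, IsLeftLcm f g h
  exists_leftGcd : ∀ f g : M, ∃ h : M, IsLeftGcd f g h
  exists_rightGcd : ∀ f g : M, ∃ h : M, IsRightGcd f g h

/-- `(M, Δ)` is a Garside monoid: the left- and right-divisors of the Garside element `Δ`
coincide, are finite in number, and generate `M`. -/
structure IsGarsideMonoid (Δ : M) : Prop extends IsGaussianMonoid M where
  leftDvd_iff_rightDvd : ∀ g : M, LeftDvd g Δ ↔ RightDvd g Δ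
  divisors_generate : Submonoid.closure {g : M | LeftDvd g Δ} = ⊤
  finite_divisors : {g : M | LeftDvd g Δ}.Finite

/-- `f` makes `G` a group of (left and right) fractions of `M`. -/
structure IsGroupOfFractions {G : Type v} [Group G] (f : M →* G) : Prop where
  injective : Function.Injective f
  left_fractions : ∀ g : G, ∃ a b : M, g = (f a)⁻¹ * f b
  right_fractions : ∀ g : G, ∃ a b : M, g = f a * (f b)⁻¹

/-- A Garside group: a group of fractions of some Garside monoid. -/
def IsGarsideGroup (G : Type u) [Group G] : Prop :=
  ∃ (N : Type u) (_ : Monoid N) (Δ : N) (f : N →* G), IsGarsideMonoid Δ ∧ IsGroupOfFractions f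

end Garside

/-! ### Monoids of I-type -/

section IType

variable {X : Type u} {M : Type v} [Monoid M]

/-- A right-I-structure on a monoid `M` generated by (the image under `ι` of) `X`: a bijection `ν`
of the free abelian monoid on `X` (written additively) onto `M` that satisfies `ν(1) = 1`,
`ν(s) = s` for `s` in `X`, and `{ν(a s) | s ∈ X} = {ν(a) s | s ∈ X}` for every `a`. -/
structure IsRightIStructure (ι : X → M) (ν : (X →₀ ℕ) → M) : Prop where
  generates : Submonoid.closure (Set.range ι) = ⊤
  bijective : Function.Bijective ν
  map_zero : ν 0 = 1
  map_single : ∀ s : X, ν (Finsupp.single s 1) = ι s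
  range_eq : ∀ a : X →₀ ℕ,
    (Set.range fun s : X => ν (a + Finsupp.single s 1)) = Set.range fun s : X => ν a * ι s

/-- A left-I-structure: the symmetric notion, with `{ν(a s) | s ∈ X} = {s ν(a) | s ∈ X}`. -/
structure IsLeftIStructure (ι : X → M) (ν : (X →₀ ℕ) → M) : Prop where
  generates : Submonoid.closure (Set.range ι) = ⊤
  bijective : Function.Bijective ν
  map_zero : ν 0 = 1
  map_single : ∀ s : X, ν (Finsupp.single s 1) = ι s
  range_eq : ∀ a : X →₀ ℕ,
    (Set.range fun s : X => ν (a + Finsupp.single s 1)) = Set.range fun s : X => ι s * ν a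

/-- `M`, together with `ι : X → M`, is the structure monoid of `(X, *)`. -/
def IsRCStructureMonoidOf (op : X → X → X) (ι : X → M) : Prop :=
  ∃ e : RCStructureMonoid op ≃* M, ∀ x : X, e (PresentedMonoid.of (rcRel op) x) = ι x

/-- `M`, together with `ι : X → M`, is the structure monoid of `(X, ρ)`. -/
def IsStructureMonoidOf (ρ : X × X → X × X) (ι : X → M) : Prop :=
  ∃ e : StructureMonoid ρ ≃* M, ∀ x : X, e (PresentedMonoid.of (solutionRel ρ) x) = ι x

end IType

end YB

universe w

namespace YB

/-! ### Monoids with a bijective degree cocycle -/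

/-! The RC law says exactly that the inverses of the left translations respect the relations `a (a *
b) = b (b * a)`. So the structure monoid acts on `X`, and each generator `x` acts on the free
abelian monoid by the affine map `a ↦ x + (perm x)⁻¹ a`. Evaluation at `0` is a degree map with `deg
(f g) = deg f + act f (deg g)`. It is bijective (`surjective_affine_zero`, `injective_affine_zero`),
so its inverse is a right-I-structure, and left divisibility becomes the componentwise order, which
is a lattice (`leftDvd_iff`). Right divisibility is left divisibility in the opposite monoid, which
is the structure monoid of the flipped solution; this needs the RC-quasigroup to come from a
solution, that is, to be bijective. Finiteness of `X` guarantees it, because `x ↦ x * x` is then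
injective (`injective_op_self`). The same affine formulas over `ℤ` embed the monoid in its group,
and common multiples yield fractions. Conversely, left multiplication by a generator, read through a
right-I-structure, sends covers to covers. Such a map is affine
(`eq_add_mapDomain_of_forall_add_single`), and its linear part is the inverse of a left translation
of the required operation. -/

theorem mapDomain_perm_mul {X N : Type*} [AddCommMonoid N] (p q : Equiv.Perm X) (a : X →₀ N) :
    a.mapDomain (p * q) = (a.mapDomain q).mapDomain p := by
  rw [Equiv.Perm.coe_mul, Finsupp.mapDomain_comp]

theorem mapDomain_perm_one {X N : Type*} [AddCommMonoid N] (a : X →₀ N) :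
    a.mapDomain (1 : Equiv.Perm X) = a := by
  rw [Equiv.Perm.coe_one, Finsupp.mapDomain_id]

theorem mapDomain_perm_mul_inv {X N : Type*} [AddCommMonoid N] (p : Equiv.Perm X) (a : X →₀ N) :
    (a.mapDomain ⇑p⁻¹).mapDomain p = a := by
  rw [← mapDomain_perm_mul, mul_inv_cancel, mapDomain_perm_one]

/-- A bijection of a monoid `M` onto the free abelian monoid on `X` that is a cocycle for an action
of `M` on `X`. -/
structure DegreeCocycle (X : Type u) (M : Type v) [Monoid M] where
  /-- The degree map. -/
  deg : M → X →₀ ℕ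
  /-- The action on the generators. -/
  act : M →* Equiv.Perm X
  deg_mul : ∀ f g : M, deg (f * g) = deg f + (deg g).mapDomain (act f)
  bijective_deg : Function.Bijective deg

namespace DegreeCocycle

variable {X : Type u} {M : Type v} [Monoid M] (c : DegreeCocycle X M)

include c

theorem deg_one : c.deg 1 = 0 := by
  have h := c.deg_mul 1 1
  rw [mul_one, map_one, mapDomain_perm_one] at h
  exact left_eq_add.1 h

theorem mul_left_cancel {f g h : M} (e : f * g = f * h) : g = h := by
  apply c.bijective_deg.injective
  have := congrArg c.deg e
  rw [c.deg_mul, c.deg_mul, add_right_inj] at this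
  exact Finsupp.mapDomain_injective (c.act f).injective this

/-- The quotient is forced: its degree is `deg g - deg f`, untwisted by `act f`. Left divisibility
is thus the product order, and lcms and gcds are suprema and infima of degrees. -/
theorem leftDvd_iff {f g : M} : LeftDvd f g ↔ c.deg f ≤ c.deg g := by
  constructor
  · rintro ⟨h, rfl⟩
    rw [c.deg_mul]
    exact le_self_add
  · intro hle
    obtain ⟨h, hh⟩ := c.bijective_deg.surjective
      ((c.deg g - c.deg f).mapDomain ⇑(c.act f)⁻¹)
    refine ⟨h, c.bijective_deg.injective ?_⟩
    rw [c.deg_mul, hh, mapDomain_perm_mul_inv, add_tsub_cancel_of_le hle]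

theorem exists_isRightLcm (f g : M) : ∃ h : M, IsRightLcm f g h := by
  obtain ⟨h, hh⟩ := c.bijective_deg.surjective (c.deg f ⊔ c.deg g)
  refine ⟨h, ?_⟩
  simp only [IsRightLcm, c.leftDvd_iff, hh]
  exact ⟨le_sup_left, le_sup_right, fun k => sup_le⟩

theorem exists_isLeftGcd (f g : M) : ∃ h : M, IsLeftGcd f g h := by
  obtain ⟨h, hh⟩ := c.bijective_deg.surjective (c.deg f ⊓ c.deg g)
  refine ⟨h, ?_⟩
  simp only [IsLeftGcd, c.leftDvd_iff, hh]
  exact ⟨inf_le_left, inf_le_right, fun k => le_inf⟩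

theorem exists_length :
    ∃ l : M → ℕ, (∀ f g : M, l f + l g ≤ l (f * g)) ∧ ∀ g : M, g ≠ 1 → l g ≠ 0 := by
  refine ⟨fun m => (c.deg m).degree, fun f g => ?_, fun g hg h => hg ?_⟩
  · simp only [c.deg_mul, map_add, Finsupp.degree_mapDomain, le_refl]
  · rw [Finsupp.degree_eq_zero_iff] at h
    exact c.bijective_deg.injective (h.trans c.deg_one.symm)

/-- Induction on the elements of a monoid with a degree cocycle, by left multiplication by
atoms. -/
theorem induction_left {P : M → Prop} (one : P 1)
    (mul : ∀ (s : X) (x m : M), c.deg x = Finsupp.single s 1 → P m → P (x * m)) (m : M) : P m := by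
  induction hn : (c.deg m).degree generalizing m with
  | zero =>
    rw [Finsupp.degree_eq_zero_iff] at hn
    rwa [c.bijective_deg.injective (hn.trans c.deg_one.symm)]
  | succ n ih =>
    have hne : c.deg m ≠ 0 := by
      intro h
      rw [h, map_zero] at hn
      omega
    obtain ⟨s, hs⟩ := Finsupp.ne_iff.1 hne
    obtain ⟨x, hx⟩ := c.bijective_deg.surjective (Finsupp.single s 1)
    have hle : LeftDvd x m := by
      rw [c.leftDvd_iff, hx, Finsupp.single_le_iff]
      exact Nat.one_le_iff_ne_zero.2 hs
    obtain ⟨m', rfl⟩ := hle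
    refine mul s x m' hx (ih m' ?_)
    rw [c.deg_mul, map_add, Finsupp.degree_mapDomain, hx, Finsupp.degree_single] at hn
    omega

end DegreeCocycle

/-! ### Right divisibility through the opposite monoid, and the Garside element. -/

theorem rightDvd_iff_op {M : Type u} [Monoid M] {f g : M} :
    RightDvd f g ↔ LeftDvd (MulOpposite.op f) (MulOpposite.op g) := by
  constructor
  · rintro ⟨h, rfl⟩
    exact ⟨MulOpposite.op h, rfl⟩
  · rintro ⟨h, hh⟩
    exact ⟨h.unop, congrArg MulOpposite.unop hh⟩

namespace DegreeCocycle

variable {X : Type u} {Y : Type w} {M : Type v} [Monoid M]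

theorem isGaussianMonoid (c : DegreeCocycle X M) (d : DegreeCocycle Y Mᵐᵒᵖ) :
    IsGaussianMonoid M where
  mul_left_cancel _ _ _ := c.mul_left_cancel
  mul_right_cancel f g h e :=
    MulOpposite.op_injective (d.mul_left_cancel (congrArg MulOpposite.op e))
  exists_length := c.exists_length
  exists_rightLcm := c.exists_isRightLcm
  exists_leftLcm f g := by
    obtain ⟨h, h₁, h₂, h₃⟩ := d.exists_isRightLcm (.op f) (.op g)
    refine ⟨h.unop, rightDvd_iff_op.2 h₁, rightDvd_iff_op.2 h₂, fun k hf hg => ?_⟩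
    exact rightDvd_iff_op.2 (h₃ _ (rightDvd_iff_op.1 hf) (rightDvd_iff_op.1 hg))
  exists_leftGcd := c.exists_isLeftGcd
  exists_rightGcd f g := by
    obtain ⟨h, h₁, h₂, h₃⟩ := d.exists_isLeftGcd (.op f) (.op g)
    refine ⟨h.unop, rightDvd_iff_op.2 h₁, rightDvd_iff_op.2 h₂, fun k hf hg => ?_⟩
    exact rightDvd_iff_op.2 (h₃ _ (rightDvd_iff_op.1 hf) (rightDvd_iff_op.1 hg))

theorem exists_isGarsideMonoid [Finite X] (c : DegreeCocycle X M) (hM : IsGaussianMonoid M) :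
    ∃ Δ : M, IsGarsideMonoid Δ := by
  -- The all-ones vector is fixed by every permutation of `X`, so the twist in the degree formula
  -- does not affect comparisons with it.
  obtain ⟨Δ, hΔ⟩ := c.bijective_deg.surjective (Finsupp.equivFunOnFinite.symm fun _ => 1)
  have hfin : {g : M | LeftDvd g Δ}.Finite := by
    have : {g : M | LeftDvd g Δ} = c.deg ⁻¹' Set.Icc 0 (c.deg Δ) := by
      ext g
      exact c.leftDvd_iff.trans (and_iff_right zero_le).symm
    classical
    rw [this]
    exact (Set.finite_Icc _ _).preimage c.bijective_deg.injective.injOn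
  have hright : ∀ f g : M, f * g = Δ → LeftDvd g Δ := by
    intro f g h
    rw [c.leftDvd_iff]
    have h' := congrArg c.deg h
    rw [c.deg_mul] at h'
    intro s
    have := DFunLike.congr_fun h' (c.act f s)
    rw [Finsupp.add_apply, Finsupp.mapDomain_apply (c.act f).injective, hΔ] at this
    simp only [Finsupp.equivFunOnFinite_symm_apply_apply] at this
    rw [hΔ, Finsupp.equivFunOnFinite_symm_apply_apply]
    omega
  -- Taking complements in `Δ` maps the finite set of left-divisors to itself, injectively by right
  -- cancellation, hence onto: every left-divisor is also a right-divisor.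
  choose! k hk using fun (f : M) (hf : LeftDvd f Δ) => hf
  have hmaps : Set.MapsTo k {g : M | LeftDvd g Δ} {g : M | LeftDvd g Δ} :=
    fun f hf => hright f (k f) (hk f hf)
  have hinj : Set.InjOn k {g : M | LeftDvd g Δ} := by
    intro f hf g hg e
    refine hM.mul_right_cancel (k f) f g ?_
    rw [hk f hf, e, hk g hg]
  refine ⟨Δ, hM, fun g => ⟨fun hg => ?_, fun ⟨f, hf⟩ => hright f g hf⟩, ?_, hfin⟩
  · obtain ⟨f, hf, rfl⟩ := ((hfin.injOn_iff_bijOn_of_mapsTo hmaps).1 hinj).surjOn hg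
    exact ⟨f, hk f hf⟩
  · rw [Submonoid.eq_top_iff']
    refine c.induction_left (one_mem _) fun s x m hx hm => mul_mem ?_ hm
    refine Submonoid.subset_closure (c.leftDvd_iff.2 ?_)
    rw [hx, Finsupp.single_le_iff, hΔ]
    simp

/-- A degree cocycle can be transported along an isomorphism. -/
def congr {N : Type w} [Monoid N] (c : DegreeCocycle X M) (e : N ≃* M) : DegreeCocycle X N where
  deg n := c.deg (e n)
  act := c.act.comp e.toMonoidHom
  deg_mul f g := by
    rw [map_mul, c.deg_mul]
    rfl
  bijective_deg := c.bijective_deg.comp e.bijective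

theorem isRightIStructure (c : DegreeCocycle X M) (ι : X → M)
    (hι : ∀ s, c.deg (ι s) = Finsupp.single s 1) :
    IsRightIStructure ι (Equiv.ofBijective c.deg c.bijective_deg).symm where
  generates := by
    rw [Submonoid.eq_top_iff']
    refine c.induction_left (one_mem _) fun s x m hx hm => mul_mem ?_ hm
    rw [← c.bijective_deg.injective ((hι s).trans hx.symm)]
    exact Submonoid.subset_closure ⟨s, rfl⟩
  bijective := Equiv.bijective _
  map_zero := by
    rw [Equiv.symm_apply_eq, Equiv.ofBijective_apply, c.deg_one]
  map_single s := by
    rw [Equiv.symm_apply_eq, Equiv.ofBijective_apply, hι]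
  range_eq a := by
    obtain ⟨m, rfl⟩ := (Equiv.ofBijective c.deg c.bijective_deg).surjective a
    have key : ∀ s, (Equiv.ofBijective c.deg c.bijective_deg).symm
        (c.deg m + Finsupp.single (c.act m s) 1) = m * ι s := by
      intro s
      rw [Equiv.symm_apply_eq, Equiv.ofBijective_apply, c.deg_mul, hι, Finsupp.mapDomain_single]
    simp only [Equiv.symm_apply_apply, ← key]
    exact ((c.act m).surjective.range_comp _).symm

end DegreeCocycle

/-! ### Groups of fractions -/

theorem IsGaussianMonoid.isGroupOfFractions {M : Type u} [Monoid M] {G : Type v} [Group G]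
    (hM : IsGaussianMonoid M) (f : M →* G) (hf : Function.Injective f)
    (hgen : Subgroup.closure (Set.range f) = ⊤) : IsGroupOfFractions f := by
  have hright : ∀ g : G, ∃ a b : M, g = f a * (f b)⁻¹ := by
    intro g
    have hg : g ∈ Subgroup.closure (Set.range f) := by
      rw [hgen]
      trivial
    induction hg using Subgroup.closure_induction_left with
    | one => exact ⟨1, 1, by simp⟩
    | mul_left x hx y _ ih =>
      obtain ⟨m, rfl⟩ := hx
      obtain ⟨a, b, rfl⟩ := ih
      exact ⟨m * a, b, by rw [map_mul, mul_assoc]⟩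
    | inv_mul_cancel x hx y _ ih =>
      obtain ⟨m, rfl⟩ := hx
      obtain ⟨a, b, rfl⟩ := ih
      -- From the common multiple `m u = a v` one gets `m⁻¹ a = u v⁻¹`, hence `m⁻¹ a b⁻¹ = u (b
      -- v)⁻¹`.
      obtain ⟨h, ⟨u, hu⟩, ⟨v, hv⟩, -⟩ := hM.exists_rightLcm m a
      refine ⟨u, b * v, ?_⟩
      have e : f m * f u = f a * f v := by rw [← map_mul, ← map_mul, hu, hv]
      rw [map_mul, mul_inv_rev, inv_mul_eq_iff_eq_mul, ← mul_assoc, ← mul_assoc, e,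
        mul_inv_cancel_right]
  refine ⟨hf, fun g => ?_, hright⟩
  obtain ⟨a, b, rfl⟩ := hright g
  obtain ⟨h, ⟨u, hu⟩, ⟨v, hv⟩, -⟩ := hM.exists_leftLcm a b
  refine ⟨u, v, ?_⟩
  have e : f u * f a = f v * f b := by rw [← map_mul, ← map_mul, hu, hv]
  rw [eq_inv_mul_iff_mul_eq, ← mul_assoc, e, mul_inv_cancel_right]

theorem IsGroupOfFractions.congr {M N : Type*} [Monoid M] [Monoid N] {G H : Type*} [Group G]
    [Group H] {f : M →* G} (hf : IsGroupOfFractions f) (eM : N ≃* M) (eG : G ≃* H) :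
    IsGroupOfFractions ((eG.toMonoidHom.comp f).comp eM.toMonoidHom) where
  injective := (eG.injective.comp hf.injective).comp eM.injective
  left_fractions g := by
    obtain ⟨a, b, h⟩ := hf.left_fractions (eG.symm g)
    refine ⟨eM.symm a, eM.symm b, ?_⟩
    rw [MulEquiv.symm_apply_eq] at h
    simpa using h
  right_fractions g := by
    obtain ⟨a, b, h⟩ := hf.right_fractions (eG.symm g)
    refine ⟨eM.symm a, eM.symm b, ?_⟩
    rw [MulEquiv.symm_apply_eq] at h
    simpa using h

/-! ### The degree cocycle of the structure monoid of an RC-quasigroup -/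

theorem presentedMonoid_induction_left {X : Type u} {r : FreeMonoid X → FreeMonoid X → Prop}
    {P : PresentedMonoid r → Prop} (one : P 1)
    (mul : ∀ x m, P m → P (PresentedMonoid.of r x * m)) (m : PresentedMonoid r) : P m := by
  have hm : m ∈ Submonoid.closure (Set.range (PresentedMonoid.of r)) := by
    rw [PresentedMonoid.closure_range_of]
    trivial
  induction hm using Submonoid.closure_induction_left with
  | one => exact one
  | mul_left x hx y _ ih =>
    obtain ⟨s, rfl⟩ := hx
    exact mul s y ih

theorem presentedMonoid_eq_one_or_mul_of {X : Type u} {r : FreeMonoid X → FreeMonoid X → Prop}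
    (m : PresentedMonoid r) : m = 1 ∨ ∃ y x, m = y * PresentedMonoid.of r x := by
  have hm : m ∈ Submonoid.closure (Set.range (PresentedMonoid.of r)) := by
    rw [PresentedMonoid.closure_range_of]
    trivial
  induction hm using Submonoid.closure_induction_right with
  | one => exact .inl rfl
  | mul_right x _ y hy _ =>
    obtain ⟨s, rfl⟩ := hy
    exact .inr ⟨x, s, rfl⟩

theorem rcStructureMonoid_rel {X : Type u} (op : X → X → X) (a b : X) :
    PresentedMonoid.of (rcRel op) a * PresentedMonoid.of (rcRel op) (op a b) =
      PresentedMonoid.of (rcRel op) b * PresentedMonoid.of (rcRel op) (op b a) :=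
  PresentedMonoid.mk_eq_mk_of_rel ⟨a, b, rfl, rfl⟩

theorem rcStructureGroup_rel {X : Type u} (op : X → X → X) (a b : X) :
    (PresentedGroup.of a * PresentedGroup.of (op a b) : RCStructureGroup op) =
      PresentedGroup.of b * PresentedGroup.of (op b a) :=
  PresentedGroup.mk_eq_mk_of_mul_inv_mem ⟨a, b, rfl⟩

theorem perm_apply_inv_apply {X : Type*} (p : Equiv.Perm X) (x : X) : p (p⁻¹ x) = x :=
  p.apply_symm_apply x

namespace IsRCQuasigroup

variable {X : Type u} {op : X → X → X} (h : IsRCQuasigroup op)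

include h

/-- The left translations of an RC-quasigroup, as permutations. -/
noncomputable def perm (x : X) : Equiv.Perm X := Equiv.ofBijective (op x) (h.bijective_left x)

theorem perm_apply (x y : X) : h.perm x y = op x y := rfl

theorem perm_inv_apply (x y : X) : (h.perm x)⁻¹ (op x y) = y :=
  (h.perm x).symm_apply_apply y

theorem perm_mul_perm (x y : X) :
    h.perm (op x y) * h.perm x = h.perm (op y x) * h.perm y := by
  ext z
  exact h.rc_law x y z

theorem perm_inv_mul_perm_inv (x y : X) :
    (h.perm x)⁻¹ * (h.perm (op x y))⁻¹ = (h.perm y)⁻¹ * (h.perm (op y x))⁻¹ := by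
  rw [← mul_inv_rev, perm_mul_perm, mul_inv_rev]

/-- The affine map of the free module on `X` by which a generator `x` acts. -/
noncomputable def shift (N : Type*) [AddCommMonoidWithOne N] (x : X) (a : X →₀ N) : X →₀ N :=
  Finsupp.single x 1 + a.mapDomain ⇑(h.perm x)⁻¹

/-- The translation part is `x + y` on both sides, since `(perm x)⁻¹` sends `x * y` to `y`; the
linear parts agree by the RC law. -/
theorem shift_shift (N : Type*) [AddCommMonoidWithOne N] (x y : X) (a : X →₀ N) :
    h.shift N x (h.shift N (op x y) a) = h.shift N y (h.shift N (op y x) a) := by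
  simp only [shift, Finsupp.mapDomain_add, Finsupp.mapDomain_single, perm_inv_apply,
    ← mapDomain_perm_mul]
  rw [perm_inv_mul_perm_inv, add_left_comm]

/-- The action of the structure monoid on the generators. -/
noncomputable def act : RCStructureMonoid op →* Equiv.Perm X :=
  PresentedMonoid.lift (fun x => (h.perm x)⁻¹) <| by
    rintro _ _ ⟨a, b, rfl, rfl⟩
    simp only [map_mul, FreeMonoid.lift_eval_of]
    exact h.perm_inv_mul_perm_inv a b

theorem act_of (x : X) : h.act (PresentedMonoid.of _ x) = (h.perm x)⁻¹ := rfl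

/-- The affine action of the structure monoid on the free abelian monoid. -/
noncomputable def affine : RCStructureMonoid op →* Function.End (X →₀ ℕ) :=
  PresentedMonoid.lift (M := Function.End (X →₀ ℕ)) (fun x => h.shift ℕ x) <| by
    rintro _ _ ⟨a, b, rfl, rfl⟩
    simp only [map_mul]
    exact funext (h.shift_shift ℕ a b)

theorem affine_of_mul (x : X) (m : RCStructureMonoid op) (a : X →₀ ℕ) :
    h.affine (PresentedMonoid.of _ x * m) a = h.shift ℕ x (h.affine m a) := by
  rw [map_mul]
  rfl

/-- The affine map of `m` has linear part `h.act m`, which makes its value at `0` a cocycle. -/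
theorem affine_eq (m : RCStructureMonoid op) (a : X →₀ ℕ) :
    h.affine m a = h.affine m 0 + a.mapDomain (h.act m) := by
  induction m using presentedMonoid_induction_left with
  | one =>
    rw [map_one, map_one, mapDomain_perm_one]
    exact (zero_add a).symm
  | mul x m ih =>
    rw [affine_of_mul, affine_of_mul, ih, map_mul, act_of, mapDomain_perm_mul]
    simp only [shift, Finsupp.mapDomain_add, add_assoc]

theorem affine_mul_zero (f g : RCStructureMonoid op) :
    h.affine (f * g) 0 = h.affine f 0 + (h.affine g 0).mapDomain (h.act f) := by
  rw [← h.affine_eq, map_mul]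
  rfl

theorem affine_of_zero (x : X) : h.affine (PresentedMonoid.of _ x) 0 = Finsupp.single x 1 := by
  rw [← mul_one (PresentedMonoid.of _ x), affine_of_mul, map_one]
  change h.shift ℕ x 0 = _
  rw [shift, Finsupp.mapDomain_zero, add_zero]

theorem affine_mul_of_zero (m : RCStructureMonoid op) (x : X) :
    h.affine (m * PresentedMonoid.of _ x) 0 =
      h.affine m 0 + Finsupp.single (h.act m x) 1 := by
  rw [affine_mul_zero, affine_of_zero, Finsupp.mapDomain_single]

theorem surjective_affine_zero (a : X →₀ ℕ) : ∃ m, h.affine m 0 = a := by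
  have step : ∀ (a : X →₀ ℕ) (s : X), (∃ m, h.affine m 0 = a) →
      ∃ m, h.affine m 0 = Finsupp.single s 1 + a := by
    rintro a s ⟨m, rfl⟩
    refine ⟨m * PresentedMonoid.of _ ((h.act m)⁻¹ s), ?_⟩
    rw [affine_mul_of_zero, perm_apply_inv_apply, add_comm]
  induction a using Finsupp.induction with
  | zero => exact ⟨1, by rw [map_one]; rfl⟩
  | single_add s n a _ _ ih =>
    clear * - ih step
    induction n with
    | zero => simpa using ih
    | succ n ihn =>
      rw [add_comm n 1, Finsupp.single_add, add_assoc]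
      exact step _ s ihn

/-- Induction on the total degree, removing the last letters of `m = y x` and `m' = y' x'`. If both
letters add the same basis vector, induction gives `y = y'`. Otherwise the degrees of `y` and `y'`
each exceed a common vector by one basis vector; surjectivity realizes that vector by some `z`,
induction gives `y = z t` and `y' = z t'`, and then `x = t * t'`, `x' = t' * t`, so a single
defining relation identifies the two products. -/
theorem injective_affine_zero {m m' : RCStructureMonoid op}
    (e : h.affine m 0 = h.affine m' 0) : m = m' := by
  induction hn : (h.affine m 0).degree generalizing m m' with
  | zero =>
    have aux : ∀ m : RCStructureMonoid op, (h.affine m 0).degree = 0 → m = 1 := by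
      intro m hm
      obtain rfl | ⟨y, x, rfl⟩ := presentedMonoid_eq_one_or_mul_of m
      · rfl
      · rw [affine_mul_of_zero, map_add, Finsupp.degree_single] at hm
        omega
    rw [aux m hn, aux m' (e ▸ hn)]
  | succ n ih =>
    have aux : ∀ m : RCStructureMonoid op, (h.affine m 0).degree = n + 1 →
        ∃ y x, m = y * PresentedMonoid.of _ x ∧ (h.affine y 0).degree = n := by
      intro m hm
      obtain rfl | ⟨y, x, rfl⟩ := presentedMonoid_eq_one_or_mul_of m
      · rw [map_one] at hm
        change (0 : X →₀ ℕ).degree = n + 1 at hm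
        simp at hm
      · rw [affine_mul_of_zero, map_add, Finsupp.degree_single] at hm
        exact ⟨y, x, rfl, by omega⟩
    obtain ⟨y, x, rfl, hy⟩ := aux m hn
    obtain ⟨y', x', rfl, hy'⟩ := aux m' (e ▸ hn)
    rw [affine_mul_of_zero, affine_mul_of_zero] at e
    by_cases hs : h.act y x = h.act y' x'
    · rw [hs, add_left_inj] at e
      obtain rfl := ih e hy
      rw [(h.act y).injective hs]
    · obtain ⟨a, ha, ha'⟩ : ∃ a, h.affine y 0 = a + Finsupp.single (h.act y' x') 1 ∧
          h.affine y' 0 = a + Finsupp.single (h.act y x) 1 := by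
        have hle : Finsupp.single (h.act y' x') 1 ≤ h.affine y 0 := by
          rw [Finsupp.single_le_iff]
          have := DFunLike.congr_fun e (h.act y' x')
          rw [Finsupp.add_apply, Finsupp.add_apply, Finsupp.single_eq_same,
            Finsupp.single_eq_of_ne (Ne.symm hs)] at this
          omega
        obtain ⟨a, ha⟩ := exists_add_of_le hle
        refine ⟨a, by rw [ha, add_comm], ?_⟩
        rw [ha, add_comm _ a, add_right_comm, add_left_inj] at e
        exact e.symm
      obtain ⟨z, rfl⟩ := h.surjective_affine_zero a
      have key : ∀ t, h.affine z 0 + Finsupp.single t 1 =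
          h.affine (z * PresentedMonoid.of _ ((h.act z)⁻¹ t)) 0 := by
        intro t
        rw [affine_mul_of_zero, perm_apply_inv_apply]
      have hz := ih (ha.trans (key _)) hy
      have hz' := ih (ha'.trans (key _)) hy'
      generalize hu : (h.act z)⁻¹ (h.act y' x') = t at hz
      generalize hu' : (h.act z)⁻¹ (h.act y x) = t' at hz'
      rw [Equiv.Perm.inv_eq_iff_eq] at hu hu'
      rw [hz, map_mul, act_of, Equiv.Perm.mul_apply, (h.act z).apply_eq_iff_eq,
        Equiv.Perm.inv_eq_iff_eq, perm_apply] at hu'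
      rw [hz', map_mul, act_of, Equiv.Perm.mul_apply, (h.act z).apply_eq_iff_eq,
        Equiv.Perm.inv_eq_iff_eq, perm_apply] at hu
      rw [hz, hz', hu, hu', mul_assoc, mul_assoc, rcStructureMonoid_rel]

/-- The degree cocycle of the structure monoid of an RC-quasigroup. -/
noncomputable def cocycle : DegreeCocycle X (RCStructureMonoid op) where
  deg m := h.affine m 0
  act := h.act
  deg_mul := h.affine_mul_zero
  bijective_deg := ⟨fun _ _ => h.injective_affine_zero, h.surjective_affine_zero⟩

theorem cocycle_deg_of (x : X) :
    h.cocycle.deg (PresentedMonoid.of _ x) = Finsupp.single x 1 :=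
  h.affine_of_zero x

theorem cocycle_act_of (x : X) : h.cocycle.act (PresentedMonoid.of _ x) = (h.perm x)⁻¹ := rfl

theorem cocycle_deg_of_mul_of (x y : X) :
    h.cocycle.deg (PresentedMonoid.of _ x * PresentedMonoid.of _ (op x y)) =
      Finsupp.single x 1 + Finsupp.single y 1 := by
  rw [DegreeCocycle.deg_mul, cocycle_deg_of, cocycle_deg_of, cocycle_act_of,
    Finsupp.mapDomain_single, perm_inv_apply]

theorem exists_isRightIStructure :
    ∃ ν : (X →₀ ℕ) → RCStructureMonoid op,
      IsRightIStructure (PresentedMonoid.of (rcRel op)) ν ∧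
      ∀ s t : X, ν (Finsupp.single s 1 + Finsupp.single t 1) =
        PresentedMonoid.of (rcRel op) s * PresentedMonoid.of (rcRel op) (op s t) := by
  refine ⟨_, h.cocycle.isRightIStructure _ h.cocycle_deg_of, fun s t => ?_⟩
  rw [Equiv.symm_apply_eq, Equiv.ofBijective_apply, cocycle_deg_of_mul_of]

/-! ### The structure group of an RC-quasigroup -/

omit h in
/-- The canonical morphism from the structure monoid to the structure group. -/
def toStructureGroup (op : X → X → X) : RCStructureMonoid op →* RCStructureGroup op :=
  PresentedMonoid.lift PresentedGroup.of <| by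
    rintro _ _ ⟨a, b, rfl, rfl⟩
    simp only [map_mul, FreeMonoid.lift_eval_of]
    exact rcStructureGroup_rel op a b

/-- The affine permutation of the free abelian group on `X` by which a generator acts. -/
noncomputable def shiftPerm (x : X) : Equiv.Perm (X →₀ ℤ) where
  toFun := h.shift ℤ x
  invFun a := (a - Finsupp.single x 1).mapDomain (h.perm x)
  left_inv a := by
    change (h.shift ℤ x a - _).mapDomain _ = a
    rw [shift, add_sub_cancel_left, mapDomain_perm_mul_inv]
  right_inv a := by
    rw [shift, ← mapDomain_perm_mul, inv_mul_cancel, mapDomain_perm_one, add_sub_cancel]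

/-- The affine action of the structure group on the free abelian group. -/
noncomputable def groupAffine : RCStructureGroup op →* Equiv.Perm (X →₀ ℤ) :=
  PresentedGroup.toGroup (f := h.shiftPerm) <| by
    rintro _ ⟨a, b, rfl⟩
    rw [map_mul, map_inv, mul_inv_eq_one, map_mul, map_mul]
    simp only [FreeGroup.lift_apply_of]
    exact Equiv.ext (h.shift_shift ℤ a b)

theorem groupAffine_toStructureGroup (m : RCStructureMonoid op) :
    h.groupAffine (toStructureGroup op m) 0 =
      (h.affine m 0).mapRange (Nat.castAddMonoidHom ℤ) (map_zero _) := by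
  induction m using presentedMonoid_induction_left with
  | one =>
    rw [map_one, map_one, map_one]
    exact (Finsupp.mapRange_zero).symm
  | mul x m ih =>
    rw [map_mul, map_mul, Equiv.Perm.mul_apply, ih, affine_of_mul]
    change h.shift ℤ x (Finsupp.mapRange _ (map_zero (Nat.castAddMonoidHom ℤ)) (h.affine m 0)) = _
    rw [shift, shift, Finsupp.mapRange_add (map_add _), Finsupp.mapRange_single]
    rw [Finsupp.mapDomain_mapRange _ _ _ _ (map_add _),
      show Nat.castAddMonoidHom ℤ 1 = 1 from Nat.cast_one]

/-- The group acts on `X →₀ ℤ`, and the image of `0` recovers the degree, which determines the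
element of the monoid. -/
theorem injective_toStructureGroup : Function.Injective (toStructureGroup op) := by
  intro m m' e
  apply h.injective_affine_zero
  have := h.groupAffine_toStructureGroup m
  rw [e, groupAffine_toStructureGroup] at this
  exact (Finsupp.mapRange_injective _ _ Nat.cast_injective this).symm

omit h in
theorem closure_range_toStructureGroup :
    Subgroup.closure (Set.range (toStructureGroup op)) = ⊤ := by
  rw [eq_top_iff, ← PresentedGroup.closure_range_of]
  refine Subgroup.closure_mono ?_
  rintro _ ⟨x, rfl⟩
  exact ⟨PresentedMonoid.of _ x, rfl⟩

/-! ### Finite RC-quasigroups are bijective -/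

/-- With `N = n + 1` the order of the finite group `Equiv.Perm X`, all `N`-th powers act trivially,
so `x ^ N` and `x' ^ N` commute and their product `k` ends with `x` as well as with `x'`. Whenever
`k = g y`, triviality of the action of `k` gives `deg k = deg g + y * y`. If `x * x = x' * x'`, the
two cofactors `g` have the same degree, hence are equal, and left cancellation gives `x = x'`. -/
theorem injective_op_self [Finite X] : Function.Injective fun x => op x x := by
  intro x x' e
  have : Fintype (Equiv.Perm X) := Fintype.ofFinite _
  obtain ⟨n, hn⟩ := Nat.exists_eq_add_one.2 (Fintype.card_pos (α := Equiv.Perm X))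
  have hact : ∀ m : RCStructureMonoid op, h.cocycle.act (m ^ (n + 1)) = 1 := by
    intro m
    rw [map_pow, ← hn, pow_card_eq_one]
  let ι := PresentedMonoid.of (rcRel op)
  have hcomm : ι x ^ (n + 1) * ι x' ^ (n + 1) = ι x' ^ (n + 1) * ι x ^ (n + 1) := by
    apply h.cocycle.bijective_deg.injective
    rw [DegreeCocycle.deg_mul, DegreeCocycle.deg_mul, hact, hact, mapDomain_perm_one,
      mapDomain_perm_one, add_comm]
  have key : ∀ (g k : RCStructureMonoid op) (y : X), g * ι y = k → h.cocycle.act k = 1 →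
      h.cocycle.deg k = h.cocycle.deg g + Finsupp.single (op y y) 1 := by
    rintro g _ y rfl hk
    rw [map_mul, cocycle_act_of, mul_inv_eq_one] at hk
    rw [DegreeCocycle.deg_mul, cocycle_deg_of, hk, Finsupp.mapDomain_single, perm_apply]
  have hk : h.cocycle.act (ι x ^ (n + 1) * ι x' ^ (n + 1)) = 1 := by
    rw [map_mul, hact, hact, mul_one]
  have h₁ := key (ι x' ^ (n + 1) * ι x ^ n) _ x (by rw [hcomm, mul_assoc, pow_succ (ι x)]) hk
  have h₂ := key (ι x ^ (n + 1) * ι x' ^ n) _ x' (by rw [mul_assoc, pow_succ (ι x')]) hk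
  rw [h₁] at h₂
  simp only at e
  rw [e, add_left_inj] at h₂
  have h₃ := h.cocycle.bijective_deg.injective h₂
  have h₄ : ι x' ^ (n + 1) * ι x ^ n * ι x = ι x' ^ (n + 1) * ι x ^ n * ι x' := by
    nth_rewrite 2 [h₃]
    rw [mul_assoc, mul_assoc, ← pow_succ, ← pow_succ, hcomm]
  have h₅ := congrArg h.cocycle.deg (h.cocycle.mul_left_cancel h₄)
  rw [cocycle_deg_of, cocycle_deg_of] at h₅
  exact Finsupp.single_left_injective one_ne_zero h₅

theorem isBijectiveRCQuasigroup [Finite X] : IsBijectiveRCQuasigroup op where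
  toIsRCQuasigroup := h
  bijective_pair := by
    rw [← Finite.injective_iff_bijective]
    -- The RC law evaluated at `x` shows that `x * x` depends only on the pair `(x * y, y * x)`.
    have key : ∀ x y : X, op x x = ((h.perm (op x y))⁻¹ * h.perm (op y x)) (op y x) := by
      intro x y
      have := h.perm_mul_perm x y
      rw [← eq_inv_mul_iff_mul_eq, ← mul_assoc] at this
      have := DFunLike.congr_fun this x
      exact this
    rintro ⟨x, y⟩ ⟨x', y'⟩ e
    simp only [Prod.mk.injEq] at e
    have hx : x = x' := by
      apply h.injective_op_self
      simp only
      rw [key x y, key x' y', e.1, e.2]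
    subst hx
    rw [(h.bijective_left x).injective e.1]

end IsRCQuasigroup

/-! ### Solutions and bijective RC-quasigroups -/

section Correspondence

variable {X : Type u} {ρ : X × X → X × X} {op : X → X → X}

/-- The operation that corresponds to a solution. -/
noncomputable def IsSolution.toOp (h : IsSolution ρ) (a b : X) : X :=
  (Equiv.ofBijective _ (h.left_nondegenerate a)).symm b

theorem IsSolution.fst_toOp (h : IsSolution ρ) (a b : X) : (ρ (a, h.toOp a b)).1 = b :=
  (Equiv.ofBijective _ (h.left_nondegenerate a)).apply_symm_apply b

theorem IsSolution.toOp_eq_of_fst (h : IsSolution ρ) {a b c : X} (e : (ρ (a, c)).1 = b) :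
    h.toOp a b = c :=
  (h.left_nondegenerate a).injective ((h.fst_toOp a b).trans e.symm)

theorem IsSolution.corresponds_toOp (h : IsSolution ρ) : Corresponds ρ h.toOp := by
  intro a b
  refine Prod.ext (h.fst_toOp a b) ?_
  symm
  apply h.toOp_eq_of_fst
  have e : (b, (ρ (a, h.toOp a b)).2) = ρ (a, h.toOp a b) := Prod.ext (h.fst_toOp a b).symm rfl
  rw [e, h.involutive]

theorem IsSolution.eq_toOp_of_corresponds (h : IsSolution ρ) (hc : Corresponds ρ op) :
    op = h.toOp := by
  funext a b
  exact (h.toOp_eq_of_fst (by rw [hc])).symm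

theorem IsSolution.isBijectiveRCQuasigroup_toOp (h : IsSolution ρ) :
    IsBijectiveRCQuasigroup h.toOp where
  rc_law x y z := by
    have hc := h.corresponds_toOp
    -- On this triple the right-hand side of the braid equation has first coordinate `z`. Comparing
    -- first coordinates gives `(ρ (y * x, (x * y) * (x * z))).1 = y * z`, which is the RC law.
    have e := congrFun h.yang_baxter (x, h.toOp x y, h.toOp (h.toOp x y) (h.toOp x z))
    simp only [Function.comp_apply, act12, act23, hc _ _, Prod.mk.injEq] at e
    have e₁ := h.toOp_eq_of_fst e.1
    rw [e₁]
    exact (h.toOp_eq_of_fst rfl).symm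
  bijective_left x := Equiv.bijective _
  bijective_pair := by
    have hc := h.corresponds_toOp
    constructor
    · rintro ⟨x, y⟩ ⟨x', y'⟩ e
      simp only [Prod.mk.injEq] at e
      have hx : x = x' := by
        apply (h.right_nondegenerate (h.toOp x y)).injective
        simp only
        rw [hc x y, e.1, hc x' y', e.2]
      subst hx
      have := hc x y
      rw [e.1, hc x y'] at this
      rw [(Prod.mk.inj this).1]
    · rintro ⟨u, v⟩
      obtain ⟨x, hx⟩ := (h.right_nondegenerate u).surjective v
      have hu : h.toOp x (ρ (x, u)).1 = u := h.toOp_eq_of_fst rfl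
      refine ⟨(x, (ρ (x, u)).1), Prod.ext hu ?_⟩
      have := hc x (ρ (x, u)).1
      rw [hu] at this
      exact (congrArg Prod.snd this).symm.trans hx

/-- The solution that corresponds to an RC-quasigroup. -/
noncomputable def IsRCQuasigroup.toSolution (h : IsRCQuasigroup op) (p : X × X) : X × X :=
  ((h.perm p.1)⁻¹ p.2, op ((h.perm p.1)⁻¹ p.2) p.1)

theorem IsRCQuasigroup.corresponds_toSolution (h : IsRCQuasigroup op) :
    Corresponds h.toSolution op := by
  intro a b
  simp only [toSolution, perm_inv_apply]

theorem IsBijectiveRCQuasigroup.isSolution_of_corresponds (h : IsBijectiveRCQuasigroup op)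
    (hc : Corresponds ρ op) : IsSolution ρ where
  yang_baxter := by
    funext ⟨x, u, v⟩
    -- Every triple has the form `(x, x * y, (x * y) * (x * z))`. In these coordinates `ρ` exchanges
    -- neighbours in the list `x, y, z`, and both sides of the braid equation reverse the list.
    obtain ⟨y, rfl⟩ := (h.bijective_left x).surjective u
    obtain ⟨w, rfl⟩ := (h.bijective_left (op x y)).surjective v
    obtain ⟨z, rfl⟩ := (h.bijective_left x).surjective w
    simp only [Function.comp_apply, act12, act23, hc _ _]
    rw [h.rc_law x y z, hc, hc, h.rc_law x z y, hc]
    simp only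
    rw [h.rc_law y z x]
  involutive := by
    rintro ⟨a, c⟩
    obtain ⟨b, rfl⟩ := (h.bijective_left a).surjective c
    rw [hc, hc]
  left_nondegenerate a := by
    have : (fun b : X => (ρ (a, b)).1) = (Equiv.ofBijective _ (h.bijective_left a)).symm := by
      funext c
      rw [Equiv.eq_symm_apply]
      obtain ⟨b, rfl⟩ := (h.bijective_left a).surjective c
      rw [hc]
      rfl
    rw [this]
    exact Equiv.bijective _
  right_nondegenerate c := by
    constructor
    · intro a a' e
      obtain ⟨b, rfl⟩ := (h.bijective_left a).surjective c
      obtain ⟨b', hb'⟩ := (h.bijective_left a').surjective (op a b)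
      simp only at e
      rw [hc, ← hb', hc] at e
      exact congrArg Prod.fst (h.bijective_pair.injective
        (a₁ := (a, b)) (a₂ := (a', b')) (Prod.ext hb'.symm e))
    · intro v
      obtain ⟨⟨a, b⟩, e⟩ := h.bijective_pair.surjective (c, v)
      simp only [Prod.mk.injEq] at e
      refine ⟨a, ?_⟩
      simp only
      rw [← e.1, hc, e.2]

theorem Corresponds.ext {ρ' : X × X → X × X} (h : IsRCQuasigroup op) (hc : Corresponds ρ op)
    (hc' : Corresponds ρ' op) : ρ = ρ' := by
  funext ⟨a, c⟩
  obtain ⟨b, rfl⟩ := (h.bijective_left a).surjective c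
  rw [hc, hc']

theorem IsSolution.existsUnique_op (h : IsSolution ρ) :
    ∃! op : X → X → X, IsBijectiveRCQuasigroup op ∧ Corresponds ρ op :=
  ⟨h.toOp, ⟨h.isBijectiveRCQuasigroup_toOp, h.corresponds_toOp⟩,
    fun _ h' => h.eq_toOp_of_corresponds h'.2⟩

theorem IsBijectiveRCQuasigroup.existsUnique_solution (h : IsBijectiveRCQuasigroup op) :
    ∃! ρ : X × X → X × X, IsSolution ρ ∧ Corresponds ρ op :=
  ⟨h.toSolution, ⟨h.isSolution_of_corresponds h.corresponds_toSolution, h.corresponds_toSolution⟩,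
    fun _ h' => h'.2.ext h.toIsRCQuasigroup h.corresponds_toSolution⟩

theorem Corresponds.solutionRel_eq (h : IsRCQuasigroup op) (hc : Corresponds ρ op) :
    solutionRel ρ = rcRel op := by
  funext u v
  apply propext
  constructor
  · rintro ⟨a, c, rfl, rfl⟩
    obtain ⟨b, rfl⟩ := (h.bijective_left a).surjective c
    exact ⟨a, b, rfl, by rw [hc]⟩
  · rintro ⟨a, b, rfl, rfl⟩
    exact ⟨a, op a b, rfl, by rw [hc]⟩

theorem Corresponds.exists_monoid_equiv (h : IsRCQuasigroup op) (hc : Corresponds ρ op) :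
    ∃ e : StructureMonoid ρ ≃* RCStructureMonoid op,
      ∀ x : X, e (PresentedMonoid.of _ x) = PresentedMonoid.of _ x := by
  unfold StructureMonoid
  rw [hc.solutionRel_eq h]
  exact ⟨MulEquiv.refl _, fun _ => rfl⟩

theorem Corresponds.exists_group_equiv (h : IsRCQuasigroup op) (hc : Corresponds ρ op) :
    ∃ e : StructureGroup ρ ≃* RCStructureGroup op,
      ∀ x : X, e (PresentedGroup.of x) = PresentedGroup.of x := by
  have key : {g : FreeGroup X | ∃ a b : X, g = FreeGroup.of a * FreeGroup.of b *
        (FreeGroup.of (ρ (a, b)).1 * FreeGroup.of (ρ (a, b)).2)⁻¹} =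
      {g : FreeGroup X | ∃ a b : X, g = FreeGroup.of a * FreeGroup.of (op a b) *
        (FreeGroup.of b * FreeGroup.of (op b a))⁻¹} := by
    ext g
    constructor
    · rintro ⟨a, c, rfl⟩
      obtain ⟨b, rfl⟩ := (h.bijective_left a).surjective c
      exact ⟨a, b, by rw [hc]⟩
    · rintro ⟨a, b, rfl⟩
      exact ⟨a, op a b, by rw [hc]⟩
  unfold StructureGroup
  rw [key]
  exact ⟨MulEquiv.refl _, fun _ => rfl⟩

end Correspondence

/-! ### The opposite solution -/

section Opposite

variable {X : Type u} {ρ : X × X → X × X}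

/-- The solution obtained by exchanging left and right. -/
def flipSolution (ρ : X × X → X × X) (p : X × X) : X × X := (ρ p.swap).swap

theorem IsSolution.flip (h : IsSolution ρ) : IsSolution (flipSolution ρ) where
  yang_baxter := by
    funext p
    exact congrArg (fun q : X × X × X => (q.2.2, q.2.1, q.1))
      (congrFun h.yang_baxter (p.2.2, p.2.1, p.1)).symm
  involutive p := congrArg Prod.swap (h.involutive p.swap)
  left_nondegenerate := h.right_nondegenerate
  right_nondegenerate := h.left_nondegenerate

theorem structureMonoid_rel (ρ : X × X → X × X) (a b : X) :
    PresentedMonoid.of (solutionRel ρ) a * PresentedMonoid.of (solutionRel ρ) b =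
      PresentedMonoid.of (solutionRel ρ) (ρ (a, b)).1 *
        PresentedMonoid.of (solutionRel ρ) (ρ (a, b)).2 :=
  PresentedMonoid.mk_eq_mk_of_rel ⟨a, b, rfl, rfl⟩

/-- The canonical anti-morphism between the structure monoids of a solution and of its opposite. -/
def flipHom (ρ : X × X → X × X) : StructureMonoid (flipSolution ρ) →* (StructureMonoid ρ)ᵐᵒᵖ :=
  PresentedMonoid.lift (fun x => MulOpposite.op (PresentedMonoid.of _ x)) <| by
    rintro _ _ ⟨a, b, rfl, rfl⟩
    simp only [map_mul, FreeMonoid.lift_eval_of]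
    exact congrArg MulOpposite.op (structureMonoid_rel ρ b a)

theorem flipHom_of (ρ : X × X → X × X) (x : X) :
    flipHom ρ (PresentedMonoid.of _ x) = MulOpposite.op (PresentedMonoid.of _ x) := rfl

/-- The canonical anti-morphism in the other direction. -/
def flipInvHom (ρ : X × X → X × X) : StructureMonoid ρ →* (StructureMonoid (flipSolution ρ))ᵐᵒᵖ :=
  -- Flipping twice returns `ρ` definitionally, so the types match.
  flipHom (flipSolution ρ)

theorem flipInvHom_of (ρ : X × X → X × X) (x : X) :
    flipInvHom ρ (PresentedMonoid.of _ x) = MulOpposite.op (PresentedMonoid.of _ x) := rfl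

theorem flipInvHom_flipHom (ρ : X × X → X × X) (m : StructureMonoid (flipSolution ρ)) :
    (flipInvHom ρ (flipHom ρ m).unop).unop = m := by
  induction m using presentedMonoid_induction_left with
  | one => simp only [map_one, MulOpposite.unop_one]
  | mul x m ih =>
    simp only [map_mul, MulOpposite.unop_mul, ih, flipHom_of, MulOpposite.unop_op, flipInvHom_of]

theorem flipHom_flipInvHom (ρ : X × X → X × X) (m : StructureMonoid ρ) :
    (flipHom ρ (flipInvHom ρ m).unop).unop = m := by
  induction m using presentedMonoid_induction_left with
  | one => simp only [map_one, MulOpposite.unop_one]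
  | mul x m ih =>
    simp only [map_mul, MulOpposite.unop_mul, ih, flipHom_of, MulOpposite.unop_op, flipInvHom_of]

/-- The structure monoid of the opposite solution is the opposite of the structure monoid. -/
def flipEquiv (ρ : X × X → X × X) : StructureMonoid (flipSolution ρ) ≃* (StructureMonoid ρ)ᵐᵒᵖ where
  toFun := flipHom ρ
  invFun m := (flipInvHom ρ m.unop).unop
  left_inv := flipInvHom_flipHom ρ
  right_inv m := congrArg MulOpposite.op (flipHom_flipInvHom ρ m.unop)
  map_mul' := map_mul _

theorem IsStructureMonoidOf.op {M : Type v} [Monoid M] {ι : X → M}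
    (h : IsStructureMonoidOf ρ ι) :
    IsStructureMonoidOf (flipSolution ρ) fun x => MulOpposite.op (ι x) := by
  obtain ⟨e, he⟩ := h
  exact ⟨(flipEquiv ρ).trans (MulEquiv.op e), fun x => congrArg MulOpposite.op (he x)⟩

theorem IsStructureMonoidOf.unop {M : Type v} [Monoid M] {ι : X → M}
    (h : IsStructureMonoidOf ρ fun x => MulOpposite.op (ι x)) :
    IsStructureMonoidOf (flipSolution ρ) ι := by
  obtain ⟨e, he⟩ := h.op
  exact ⟨e.trans (MulEquiv.opOp M).symm,
    fun x => congrArg (fun m : Mᵐᵒᵖᵐᵒᵖ => m.unop.unop) (he x)⟩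

end Opposite

/-! ### Garside structures -/

section Garside

variable {X : Type u} {ρ : X × X → X × X} {op : X → X → X}

theorem IsSolution.nonempty_cocycle (h : IsSolution ρ) :
    Nonempty (DegreeCocycle X (StructureMonoid ρ)) := by
  have hop := h.isBijectiveRCQuasigroup_toOp.toIsRCQuasigroup
  obtain ⟨e, -⟩ := h.corresponds_toOp.exists_monoid_equiv hop
  exact ⟨hop.cocycle.congr e⟩

/-- Solutions, unlike RC-quasigroups, are left-right symmetric: the flipped solution has its own
degree cocycle, which governs right divisibility. -/
theorem IsSolution.isGaussianMonoid (h : IsSolution ρ) :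
    IsGaussianMonoid (StructureMonoid ρ) := by
  obtain ⟨c⟩ := h.nonempty_cocycle
  obtain ⟨d⟩ := h.flip.nonempty_cocycle
  exact c.isGaussianMonoid (d.congr (flipEquiv ρ).symm)

theorem IsBijectiveRCQuasigroup.isGaussianMonoid (h : IsBijectiveRCQuasigroup op) :
    IsGaussianMonoid (RCStructureMonoid op) := by
  have hs := h.isSolution_of_corresponds h.corresponds_toSolution
  obtain ⟨e, -⟩ := h.corresponds_toSolution.exists_monoid_equiv h.toIsRCQuasigroup
  obtain ⟨d⟩ := hs.flip.nonempty_cocycle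
  exact h.cocycle.isGaussianMonoid
    (d.congr ((MulEquiv.op e.symm).trans (flipEquiv h.toSolution).symm))

theorem IsBijectiveRCQuasigroup.isGroupOfFractions (h : IsBijectiveRCQuasigroup op) :
    IsGroupOfFractions (IsRCQuasigroup.toStructureGroup op) :=
  h.isGaussianMonoid.isGroupOfFractions _ h.injective_toStructureGroup
    IsRCQuasigroup.closure_range_toStructureGroup

theorem IsSolution.exists_isGroupOfFractions (h : IsSolution ρ) :
    ∃ f : StructureMonoid ρ →* StructureGroup ρ,
      (∀ x : X, f (PresentedMonoid.of _ x) = PresentedGroup.of x) ∧ IsGroupOfFractions f := by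
  have hop := h.isBijectiveRCQuasigroup_toOp
  obtain ⟨eM, hM⟩ := h.corresponds_toOp.exists_monoid_equiv hop.toIsRCQuasigroup
  obtain ⟨eG, hG⟩ := h.corresponds_toOp.exists_group_equiv hop.toIsRCQuasigroup
  refine ⟨_, fun x => ?_, hop.isGroupOfFractions.congr eM eG.symm⟩
  change eG.symm (IsRCQuasigroup.toStructureGroup h.toOp (eM (PresentedMonoid.of _ x))) = _
  rw [hM, MulEquiv.symm_apply_eq, hG]
  rfl

end Garside

/-! ### Monoids of I-type -/

/-- The value at `r` is the only one not taken elsewhere, so it is determined by the others; `X` may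
be infinite. -/
theorem perm_eq_of_forall_ne {X : Type*} {p q : Equiv.Perm X} (r : X)
    (h : ∀ t, t ≠ r → p t = q t) : p = q := by
  ext t
  by_cases ht : t = r
  · subst ht
    obtain ⟨s, hs⟩ := q.surjective (p t)
    by_cases hst : s = t
    · rw [← hs, hst]
    · exact absurd (p.injective ((h s hst).trans hs)) hst
  · exact h t ht

/-- A map between free abelian monoids that sends the covers of each element bijectively to covers
of its image is affine. -/
theorem eq_add_mapDomain_of_forall_add_single {X : Type*} (f : (X →₀ ℕ) → X →₀ ℕ)
    (τ : (X →₀ ℕ) → Equiv.Perm X)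
    (h : ∀ a r, f (a + Finsupp.single r 1) = f a + Finsupp.single (τ a r) 1) (a : X →₀ ℕ) :
    τ a = τ 0 ∧ f a = f 0 + a.mapDomain (τ 0) := by
  have step : ∀ a r, τ (a + Finsupp.single r 1) = τ a := by
    intro a r
    refine perm_eq_of_forall_ne r fun t ht => ?_
    -- The two ways of computing `f (a + r + t)`. At the coordinate `τ a t` the right side is
    -- positive while `τ a r` contributes nothing, which forces `τ (a + r) t = τ a t`.
    have e : f a + Finsupp.single (τ a r) 1 + Finsupp.single (τ (a + Finsupp.single r 1) t) 1 =
        f a + Finsupp.single (τ a t) 1 + Finsupp.single (τ (a + Finsupp.single t 1) r) 1 := by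
      rw [← h, ← h, ← h, ← h, add_right_comm]
    rw [add_assoc, add_assoc, add_right_inj] at e
    have e' := DFunLike.congr_fun e (τ a t)
    rw [Finsupp.add_apply, Finsupp.add_apply, Finsupp.single_eq_same,
      Finsupp.single_eq_of_ne ((τ a).injective.ne ht)] at e'
    by_contra hne
    rw [Finsupp.single_eq_of_ne (Ne.symm hne)] at e'
    omega
  induction hn : a.degree generalizing a with
  | zero =>
    rw [Finsupp.degree_eq_zero_iff] at hn
    subst hn
    simp
  | succ n ih =>
    obtain ⟨s, hs⟩ : ∃ s, a s ≠ 0 := by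
      by_contra! hall
      rw [show a = 0 from Finsupp.ext hall, map_zero] at hn
      omega
    obtain ⟨b, rfl⟩ := exists_add_of_le
      (Finsupp.single_le_iff.2 (Nat.one_le_iff_ne_zero.2 hs) : Finsupp.single s 1 ≤ a)
    rw [map_add, Finsupp.degree_single] at hn
    obtain ⟨h₁, h₂⟩ := ih b (by omega)
    rw [add_comm _ b, step, h, h₁, h₂, Finsupp.mapDomain_add, Finsupp.mapDomain_single, add_assoc]
    exact ⟨rfl, rfl⟩

namespace IsRightIStructure

variable {X : Type u} {M : Type v} [Monoid M] {ι : X → M} {ν : (X →₀ ℕ) → M}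

theorem exists_perm [Finite X] (h : IsRightIStructure ι ν) (a : X →₀ ℕ) :
    (∃ p : Equiv.Perm X, ∀ s, ν (a + Finsupp.single s 1) = ν a * ι (p s)) ∧
      Function.Injective fun s => ν a * ι s := by
  have hF : Function.Injective fun s : X => ν (a + Finsupp.single s 1) := by
    intro s t e
    exact Finsupp.single_left_injective one_ne_zero (add_left_cancel (h.bijective.injective e))
  have hmem : ∀ s, ∃ t, ν a * ι t = ν (a + Finsupp.single s 1) := by
    intro s
    have : ν (a + Finsupp.single s 1) ∈ Set.range fun s : X => ν a * ι s := by
      rw [← h.range_eq]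
      exact ⟨s, rfl⟩
    exact this
  choose p hp using hmem
  have hpinj : Function.Injective p := by
    intro s t e
    apply hF
    simp only
    rw [← hp, ← hp, e]
  -- Finiteness replaces cancellation in `M`: `p` is onto, so the products `ν a * ι s` are pairwise
  -- distinct.
  have hpbij := Finite.injective_iff_bijective.1 hpinj
  refine ⟨⟨Equiv.ofBijective p hpbij, fun s => (hp s).symm⟩, fun s t e => ?_⟩
  obtain ⟨s, rfl⟩ := hpbij.surjective s
  obtain ⟨t, rfl⟩ := hpbij.surjective t
  simp only [hp] at e
  rw [hF e]

/-- A right-I-structure on a monoid with finitely many generators is multiplicative up to the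
permutations associated with the generators. -/
theorem exists_mul_formula [Finite X] (h : IsRightIStructure ι ν) :
    ∃ ψ : X → Equiv.Perm X, (∀ s t, ν (Finsupp.single s 1 + Finsupp.single t 1) =
        ι s * ι (ψ s t)) ∧
      ∀ s a, ν (Finsupp.single s 1 + a) = ι s * ν (a.mapDomain (ψ s)) := by
  choose ψ hψ using fun a => (h.exists_perm a).1
  have hinj : ∀ a, Function.Injective fun s => ν a * ι s := fun a => (h.exists_perm a).2
  have hzero : ψ 0 = 1 := by
    ext s
    apply hinj 0
    simp only
    rw [← hψ, zero_add, h.map_single, h.map_zero, one_mul, Equiv.Perm.one_apply]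
  refine ⟨fun s => ψ (Finsupp.single s 1), fun s t => by rw [hψ, h.map_single], fun s a => ?_⟩
  -- Here `f` is left multiplication by `ι s` transported to degrees. Its permutation at `a` is `(ψ
  -- (f a))⁻¹ * ψ a`, which at `0` equals `(ψ (single s 1))⁻¹`.
  choose f hf using fun a => h.bijective.surjective (ι s * ν a)
  have hf0 : f 0 = Finsupp.single s 1 := by
    apply h.bijective.injective
    rw [hf, h.map_zero, mul_one, h.map_single]
  have key := eq_add_mapDomain_of_forall_add_single f (fun a => (ψ (f a))⁻¹ * ψ a) (by
    intro a r
    apply h.bijective.injective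
    rw [hf, hψ, hψ, Equiv.Perm.mul_apply, perm_apply_inv_apply, hf, mul_assoc])
    (a.mapDomain (ψ (Finsupp.single s 1)))
  rw [hf0, hzero, mul_one, ← mapDomain_perm_mul, inv_mul_cancel, mapDomain_perm_one] at key
  rw [← key.2, hf]

theorem existsUnique_op [Finite X] (h : IsRightIStructure ι ν) :
    ∃! op : X → X → X, IsRCQuasigroup op ∧ IsRCStructureMonoidOf op ι ∧
      ∀ s t : X, ν (Finsupp.single s 1 + Finsupp.single t 1) = ι s * ι (op s t) := by
  have hinj : ∀ a, Function.Injective fun s => ν a * ι s := fun a => (h.exists_perm a).2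
  obtain ⟨ψ, hψ, hmul⟩ := h.exists_mul_formula
  have hrc : IsRCQuasigroup fun s t => ψ s t := by
    refine ⟨fun s t r => ?_, fun s => (ψ s).bijective⟩
    -- The left side is symmetric in `s` and `t`; cancelling the common factor on the right gives
    -- the RC law.
    have key : ∀ s t, ν (Finsupp.single s 1 + Finsupp.single t 1 + Finsupp.single r 1) =
        ν (Finsupp.single s 1 + Finsupp.single t 1) * ι (ψ (ψ s t) (ψ s r)) := by
      intro s t
      rw [add_assoc, hmul, Finsupp.mapDomain_add, Finsupp.mapDomain_single,
        Finsupp.mapDomain_single, hψ, hψ, mul_assoc]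
    apply hinj (Finsupp.single s 1 + Finsupp.single t 1)
    simp only
    rw [← key, add_comm (Finsupp.single s 1), ← key]
  have hrel : ∀ a b : FreeMonoid X, rcRel (fun s t => ψ s t) a b →
      FreeMonoid.lift ι a = FreeMonoid.lift ι b := by
    rintro _ _ ⟨a, b, rfl, rfl⟩
    simp only [map_mul, FreeMonoid.lift_eval_of]
    rw [← hψ, ← hψ, add_comm]
  -- The induced morphism is `ν` after the degree map, a composite of two bijections.
  have hlift : ∀ m, PresentedMonoid.lift ι hrel m = ν (hrc.cocycle.deg m) := by
    intro m
    induction m using presentedMonoid_induction_left with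
    | one => rw [map_one, DegreeCocycle.deg_one, h.map_zero]
    | mul x m ih =>
      rw [map_mul, ih, DegreeCocycle.deg_mul, hrc.cocycle_deg_of, hmul, hrc.cocycle_act_of,
        PresentedMonoid.lift_of]
      exact congrArg (fun a => ι x * ν a)
        (mapDomain_perm_mul_inv (hrc.perm x) (hrc.cocycle.deg m)).symm
  refine ⟨fun s t => ψ s t, ⟨hrc, ⟨MulEquiv.ofBijective (PresentedMonoid.lift ι hrel) ?_,
    fun x => rfl⟩, hψ⟩, ?_⟩
  · rw [show ⇑(PresentedMonoid.lift ι hrel) = ν ∘ hrc.cocycle.deg from funext hlift]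
    exact h.bijective.comp hrc.cocycle.bijective_deg
  · rintro op ⟨-, -, hop⟩
    funext s t
    apply hinj (Finsupp.single s 1)
    simp only
    rw [h.map_single, ← hop, ← hψ]

end IsRightIStructure

/-! ### Passage to the opposite monoid and the equivalent descriptions of monoids of I-type. -/

section Equivalences

variable {X : Type u} {M : Type v} [Monoid M] {ι : X → M} {ν : (X →₀ ℕ) → M}

theorem closure_range_op_eq_top_iff :
    Submonoid.closure (Set.range fun x => MulOpposite.op (ι x)) = ⊤ ↔
      Submonoid.closure (Set.range ι) = ⊤ := by
  simp only [Submonoid.eq_top_iff']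
  constructor
  · intro h m
    have key : ∀ x ∈ Submonoid.closure (Set.range fun x => MulOpposite.op (ι x)),
        x.unop ∈ Submonoid.closure (Set.range ι) := by
      intro x hx
      induction hx using Submonoid.closure_induction with
      | mem x hx =>
        obtain ⟨s, rfl⟩ := hx
        exact Submonoid.subset_closure ⟨s, rfl⟩
      | one => exact one_mem _
      | mul x y _ _ hx hy => exact mul_mem hy hx
    exact key _ (h (MulOpposite.op m))
  · intro h m
    have key : ∀ x ∈ Submonoid.closure (Set.range ι), MulOpposite.op x ∈
        Submonoid.closure (Set.range fun x => MulOpposite.op (ι x)) := by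
      intro x hx
      induction hx using Submonoid.closure_induction with
      | mem x hx =>
        obtain ⟨s, rfl⟩ := hx
        exact Submonoid.subset_closure ⟨s, rfl⟩
      | one => exact one_mem _
      | mul x y _ _ hx hy => exact mul_mem hy hx
    exact key _ (h m.unop)

theorem IsLeftIStructure.op (h : IsLeftIStructure ι ν) :
    IsRightIStructure (fun x => MulOpposite.op (ι x)) fun a => MulOpposite.op (ν a) where
  generates := closure_range_op_eq_top_iff.2 h.generates
  bijective := MulOpposite.op_bijective.comp h.bijective
  map_zero := congrArg MulOpposite.op h.map_zero
  map_single s := congrArg MulOpposite.op (h.map_single s)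
  range_eq a := by
    have := congrArg (MulOpposite.op '' ·) (h.range_eq a)
    simp only [← Set.range_comp] at this
    exact this

theorem IsRightIStructure.unop {ν : (X →₀ ℕ) → Mᵐᵒᵖ}
    (h : IsRightIStructure (fun x => MulOpposite.op (ι x)) ν) :
    IsLeftIStructure ι fun a => (ν a).unop where
  generates := closure_range_op_eq_top_iff.1 h.generates
  bijective := MulOpposite.unop_bijective.comp h.bijective
  map_zero := congrArg MulOpposite.unop h.map_zero
  map_single s := congrArg MulOpposite.unop (h.map_single s)
  range_eq a := by
    have := congrArg (MulOpposite.unop '' ·) (h.range_eq a)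
    simp only [← Set.range_comp] at this
    exact this

theorem exists_isRightIStructure_iff [Finite X] :
    (∃ ν : (X →₀ ℕ) → M, IsRightIStructure ι ν) ↔
      ∃ op : X → X → X, IsRCQuasigroup op ∧ IsRCStructureMonoidOf op ι := by
  constructor
  · rintro ⟨ν, h⟩
    obtain ⟨op, ⟨h₁, h₂, -⟩, -⟩ := h.existsUnique_op
    exact ⟨op, h₁, h₂⟩
  · rintro ⟨op, h, e, he⟩
    refine ⟨_, (h.cocycle.congr e.symm).isRightIStructure ι fun s => ?_⟩
    change h.cocycle.deg (e.symm (ι s)) = _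
    rw [← he, MulEquiv.symm_apply_apply, h.cocycle_deg_of]

theorem exists_isRCStructureMonoidOf_iff [Finite X] :
    (∃ op : X → X → X, IsRCQuasigroup op ∧ IsRCStructureMonoidOf op ι) ↔
      ∃ ρ : X × X → X × X, IsSolution ρ ∧ IsStructureMonoidOf ρ ι := by
  constructor
  · rintro ⟨op, h, e, he⟩
    obtain ⟨e', he'⟩ := h.corresponds_toSolution.exists_monoid_equiv h
    refine ⟨h.toSolution,
      h.isBijectiveRCQuasigroup.isSolution_of_corresponds h.corresponds_toSolution,
      e'.trans e, fun x => ?_⟩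
    rw [MulEquiv.trans_apply, he', he]
  · rintro ⟨ρ, h, e, he⟩
    have hop := h.isBijectiveRCQuasigroup_toOp.toIsRCQuasigroup
    obtain ⟨e', he'⟩ := h.corresponds_toOp.exists_monoid_equiv hop
    refine ⟨h.toOp, hop, e'.symm.trans e, fun x => ?_⟩
    rw [MulEquiv.trans_apply, ← he', MulEquiv.symm_apply_apply, he]

/-- A left-I-structure is a right-I-structure on the opposite monoid, and flipping the solution
returns to `M`. -/
theorem exists_isLeftIStructure_iff [Finite X] :
    (∃ ν : (X →₀ ℕ) → M, IsLeftIStructure ι ν) ↔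
      ∃ ρ : X × X → X × X, IsSolution ρ ∧ IsStructureMonoidOf ρ ι := by
  constructor
  · rintro ⟨ν, h⟩
    obtain ⟨ρ, hρ, hM⟩ := exists_isRCStructureMonoidOf_iff.1
      (exists_isRightIStructure_iff.1 ⟨_, h.op⟩)
    exact ⟨_, hρ.flip, hM.unop⟩
  · rintro ⟨ρ, hρ, hM⟩
    obtain ⟨ν, h⟩ := exists_isRightIStructure_iff.2
      (exists_isRCStructureMonoidOf_iff.2 ⟨_, hρ.flip, hM.op⟩)
    exact ⟨_, h.unop⟩

end Equivalences

end YB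

theorem mainTheorem7 (X : Type u) :
    -- involutive nondegenerate solutions and bijective RC-quasigroups correspond bijectively
    ((∀ ρ : X × X → X × X, YB.IsSolution ρ →
        ∃! op : X → X → X, YB.IsBijectiveRCQuasigroup op ∧ YB.Corresponds ρ op) ∧
      (∀ op : X → X → X, YB.IsBijectiveRCQuasigroup op →
        ∃! ρ : X × X → X × X, YB.IsSolution ρ ∧ YB.Corresponds ρ op) ∧
      (Finite X → ∀ op : X → X → X, YB.IsRCQuasigroup op → YB.IsBijectiveRCQuasigroup op)) ∧
    -- corresponding objects have the same structure monoid and the same structure group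
    (∀ (ρ : X × X → X × X) (op : X → X → X), YB.IsSolution ρ → YB.IsBijectiveRCQuasigroup op →
      YB.Corresponds ρ op →
        (∃ e : YB.StructureMonoid ρ ≃* YB.RCStructureMonoid op,
          ∀ x : X, e (PresentedMonoid.of _ x) = PresentedMonoid.of _ x) ∧
        (∃ e : YB.StructureGroup ρ ≃* YB.RCStructureGroup op,
          ∀ x : X, e (PresentedGroup.of x) = PresentedGroup.of x)) ∧
    -- structure monoids and structure groups of solutions
    (∀ ρ : X × X → X × X, YB.IsSolution ρ →
      YB.IsGaussianMonoid (YB.StructureMonoid ρ) ∧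
      (∃ f : YB.StructureMonoid ρ →* YB.StructureGroup ρ,
        (∀ x : X, f (PresentedMonoid.of _ x) = PresentedGroup.of x) ∧ YB.IsGroupOfFractions f) ∧
      (Finite X →
        (∃ Δ : YB.StructureMonoid ρ, YB.IsGarsideMonoid Δ) ∧
        YB.IsGarsideGroup (YB.StructureGroup ρ))) ∧
    -- structure monoids and structure groups of finite RC-quasigroups
    (Finite X → ∀ op : X → X → X, YB.IsRCQuasigroup op →
      (∃ Δ : YB.RCStructureMonoid op, YB.IsGarsideMonoid Δ) ∧
      YB.IsGarsideGroup (YB.RCStructureGroup op) ∧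
      (∃ f : YB.RCStructureMonoid op →* YB.RCStructureGroup op,
        (∀ x : X, f (PresentedMonoid.of _ x) = PresentedGroup.of x) ∧ YB.IsGroupOfFractions f)) ∧
    -- the structure monoid of an RC-quasigroup carries a right-I-structure that encodes the
    -- operation
    (∀ op : X → X → X, YB.IsRCQuasigroup op →
      ∃ ν : (X →₀ ℕ) → YB.RCStructureMonoid op,
        YB.IsRightIStructure (PresentedMonoid.of (YB.rcRel op)) ν ∧
        ∀ s t : X, ν (Finsupp.single s 1 + Finsupp.single t 1) =
          PresentedMonoid.of (YB.rcRel op) s * PresentedMonoid.of (YB.rcRel op) (op s t)) ∧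
    -- conversely, monoids of I-type are exactly the structure monoids
    (Finite X → ∀ (M : Type v) [Monoid M] (ι : X → M),
      (∀ ν : (X →₀ ℕ) → M, YB.IsRightIStructure ι ν →
        ∃! op : X → X → X, YB.IsRCQuasigroup op ∧ YB.IsRCStructureMonoidOf op ι ∧
          ∀ s t : X, ν (Finsupp.single s 1 + Finsupp.single t 1) = ι s * ι (op s t)) ∧
      List.TFAE [
        ∃ ν : (X →₀ ℕ) → M, YB.IsRightIStructure ι ν,
        ∃ ν : (X →₀ ℕ) → M, YB.IsLeftIStructure ι ν,
        ∃ op : X → X → X, YB.IsRCQuasigroup op ∧ YB.IsRCStructureMonoidOf op ι,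
        ∃ ρ : X × X → X × X, YB.IsSolution ρ ∧ YB.IsStructureMonoidOf ρ ι]) := by
  refine ⟨⟨fun ρ h => h.existsUnique_op, fun op h => h.existsUnique_solution,
    fun _ op h => h.isBijectiveRCQuasigroup⟩, fun ρ op _ h hc =>
    ⟨hc.exists_monoid_equiv h.toIsRCQuasigroup, hc.exists_group_equiv h.toIsRCQuasigroup⟩,
    fun ρ h => ⟨h.isGaussianMonoid, h.exists_isGroupOfFractions, fun _ => ?_⟩,
    fun _ op h => ?_, fun op h => h.exists_isRightIStructure,
    fun _ M _ ι => ⟨fun ν h => h.existsUnique_op, ?_⟩⟩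
  · obtain ⟨c⟩ := h.nonempty_cocycle
    obtain ⟨Δ, hΔ⟩ := c.exists_isGarsideMonoid h.isGaussianMonoid
    obtain ⟨f, -, hf⟩ := h.exists_isGroupOfFractions
    exact ⟨⟨Δ, hΔ⟩, _, _, Δ, f, hΔ, hf⟩
  · have hb := h.isBijectiveRCQuasigroup
    obtain ⟨Δ, hΔ⟩ := h.cocycle.exists_isGarsideMonoid hb.isGaussianMonoid
    exact ⟨⟨Δ, hΔ⟩, ⟨_, _, Δ, _, hΔ, hb.isGroupOfFractions⟩, _, fun _ => rfl,
      hb.isGroupOfFractions⟩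
  · tfae_have 1 ↔ 3 := YB.exists_isRightIStructure_iff
    tfae_have 3 ↔ 4 := YB.exists_isRCStructureMonoidOf_iff
    tfae_have 2 ↔ 4 := YB.exists_isLeftIStructure_iff
    tfae_finish
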